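/- Let $(\mu_\alpha)$ be a net of Radon (equivalently, Borel) sub-probability measures on $\mathbb{R}$ and $(t_\alpha)$ a net in $]0,+\infty[$, with the same directed index set, converging to $0$. For a continuous $h:\mathbb{R}\to\mathbb{R}$ put $$\underline\Lambda(h)=\log\liminf_\alpha\Big(\int e^{h(x)/t_\alpha}\,\mu_\alpha(dx)\Big)^{t_\alpha},\qquad \overline\Lambda(h)=\log\limsup_\alpha\Big(\int e^{h(x)/t_\alpha}\,\mu_\alpha(dx)\Big)^{t_\alpha}$$ in $[-\infty,+\infty]$; we say that $\Lambda(h)$ exists, and denote by $\Lambda(h)$ the common value, when the two are equal. For $(\lambda,\nu)\in\mathbb{R}^2$ let $h_{\lambda,\nu}(x)=\lambda x$ if $x\le 0$ and $h_{\lambda,\nu}(x)=\nu x$ if $x\ge 0$; put $\mathcal{S}=\{h_{\lambda,\nu}:(\lambda,\nu)\in\mathbb{R}^2\}$ and $L(\lambda)=\Lambda(h_{\lambda,\lambda})$. Let $l_1(x)=-\log\inf\{\liminf_\alpha\mu_\alpha(U)^{t_\alpha}: U\subset\mathbb{R}\text{ open},\ x\in U\}$. For an open interval $G$ put ${\Lambda_{|\mathcal{S}}}^*(x)=\sup_{h\in\mathcal{S}}\{h(x)-\Lambda(h)\}$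 and ${L_{|G}}^*(x)=\sup_{\lambda\in G}\{\lambda x-L(\lambda)\}$, let $\mathrm{Dom}(f)=\{f<+\infty\}$, and let $\mathrm{ran}\,{L_{|G}}'_-$ and $\mathrm{ran}\,{L_{|G}}'_+$ be the sets of values on $G$ of the left and right derivatives of $L_{|G}$. Assume that $\Lambda(h_{\lambda,\nu})$ exists for all $(\lambda,\nu)\in\mathbb{R}^2$, and that $L$ is finite on some open interval $G$ containing $0$. If $$\mathrm{ran}\,{L_{|G}}'_-\cup\mathrm{ran}\,{L_{|G}}'_+\supset\mathrm{Dom}({\Lambda_{|\mathcal{S}}}^*)\cap\{l_1>-L(0)\},$$ then $(\mu_\alpha)$ satisfies a (narrow) large deviation principle with powers $(t_\alpha)$ and rate function $J={\Lambda_{|\mathcal{S}}}^*$; that is, $J$ is a $[0,+\infty]$-valued lower semicontinuous function with $$\limsup_\alpha\mu_\alpha(F)^{t_\alpha}\le\sup_{x\in F}e^{-J(x)}\ \text{ for all closed }F\subset\mathbb{R},\qquad \sup_{x\in U}e^{-J(x)}\le\liminf_\alpha\mu_\alpha(U)^{t_\alpha}\ \text{ for all open }U\subset\mathbb{R}$$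 (with $\sup\emptyset=0$). Moreover, $J(x)={L_{|G}}^*(x)$ for all $x\in\mathrm{Dom}(J)$. -/

import Mathlib

open Filter MeasureTheory Set
open scoped ENNReal Topology

namespace LargeDev

noncomputable section

/-- `μ_α^{t_α}(e^{h/t_α}) = (∫ e^{h(x)/t_α} μ_α(dx))^{t_α}`, with values in `[0,+∞]`. -/
def scaledExpMoment {ι X : Type*} [MeasurableSpace X] (μ : ι → Measure X) (t : ι → ℝ)
    (h : X → ℝ) (i : ι) : ℝ≥0∞ :=
  (∫⁻ x, ENNReal.ofReal (Real.exp (h x / t i)) ∂(μ i)) ^ (t i)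

/-- The lower functional `log liminf μ_α^{t_α}(e^{h/t_α})`. -/
def lowerLambda {ι X : Type*} [Preorder ι] [MeasurableSpace X] (μ : ι → Measure X) (t : ι → ℝ)
    (h : X → ℝ) : EReal :=
  ENNReal.log (liminf (scaledExpMoment μ t h) atTop)

/-- The upper functional `log limsup μ_α^{t_α}(e^{h/t_α})`. -/
def upperLambda {ι X : Type*} [Preorder ι] [MeasurableSpace X] (μ : ι → Measure X) (t : ι → ℝ)
    (h : X → ℝ) : EReal :=
  ENNReal.log (limsup (scaledExpMoment μ t h) atTop)

/-- `Λ(h)` exists: the lower and the upper functional agree at `h` (possibly with an infinite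
value). -/
def LambdaExists {ι X : Type*} [Preorder ι] [MeasurableSpace X] (μ : ι → Measure X) (t : ι → ℝ)
    (h : X → ℝ) : Prop :=
  lowerLambda μ t h = upperLambda μ t h

/-- The value `Λ(h)`; it is only meaningful when `LambdaExists μ t h` holds. -/
def Lambda {ι X : Type*} [Preorder ι] [MeasurableSpace X] (μ : ι → Measure X) (t : ι → ℝ)
    (h : X → ℝ) : EReal :=
  upperLambda μ t h

/-- The piecewise linear function `h_{a,b}`, equal to `a x` for `x ≤ 0` and to `b x` for
`x ≥ 0`. -/
def hFun (a b : ℝ) (x : ℝ) : ℝ := if x ≤ 0 then a * x else b * x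

/-- The set `{h_{a,b} : (a,b) ∈ ℝ²}`. -/
def hFamily : Set (ℝ → ℝ) := {h | ∃ a b : ℝ, h = hFun a b}

/-- The generalized log-moment generating function `L(s) = Λ(h_{s,s})`. -/
def logMGF {ι : Type*} [Preorder ι] (μ : ι → Measure ℝ) (t : ι → ℝ) (s : ℝ) : EReal :=
  Lambda μ t (hFun s s)

/-- `l₁(x) = - log inf {liminf μ_α^{t_α}(U) : x ∈ U, U open}`. -/
def lOne {ι X : Type*} [Preorder ι] [TopologicalSpace X] [MeasurableSpace X]
    (μ : ι → Measure X) (t : ι → ℝ) (x : X) : EReal :=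
  - ENNReal.log (⨅ U ∈ {U : Set X | IsOpen U ∧ x ∈ U}, liminf (fun i => (μ i U) ^ (t i)) atTop)

/-- The abstract Legendre-Fenchel transform `x ↦ sup_{h ∈ S} (h(x) - Φ(h))`. -/
def abstractConj {X : Type*} (S : Set (X → ℝ)) (Φ : (X → ℝ) → EReal) (x : X) : EReal :=
  ⨆ h ∈ S, ((h x : ℝ) : EReal) - Φ h

/-- The Legendre-Fenchel transform `x ↦ sup_{s ∈ ℝ} (s x - f(s))`. -/
def legendre (f : ℝ → EReal) (x : ℝ) : EReal :=
  ⨆ s : ℝ, ((s * x : ℝ) : EReal) - f s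

open Classical in
/-- The function that coincides with `f` on `G` and takes the value `+∞` outside `G`. -/
def extendTop (f : ℝ → EReal) (G : Set ℝ) (s : ℝ) : EReal := if s ∈ G then f s else ⊤

/-- The effective domain `{f < +∞}`. -/
def effDom {X : Type*} (f : X → EReal) : Set X := {x | f x < ⊤}

/-- The range of the left derivative of `f` restricted to `G` (for `f` finite on `G`). -/
def ranLeftDeriv (f : ℝ → EReal) (G : Set ℝ) : Set ℝ :=
  {y | ∃ s ∈ G, HasDerivWithinAt (fun r => (f r).toReal) y (G ∩ Iio s) s}

/-- The range of the right derivative of `f` restricted to `G` (for `f` finite on `G`). -/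
def ranRightDeriv (f : ℝ → EReal) (G : Set ℝ) : Set ℝ :=
  {y | ∃ s ∈ G, HasDerivWithinAt (fun r => (f r).toReal) y (G ∩ Ioi s) s}

/-- `(μ_α)` satisfies the (narrow) large deviation principle with powers `(t_α)` and rate
function `J`, a `[0,+∞]`-valued lower semicontinuous function. -/
structure NarrowLDP {ι X : Type*} [Preorder ι] [TopologicalSpace X] [MeasurableSpace X]
    (μ : ι → Measure X) (t : ι → ℝ) (J : X → EReal) : Prop where
  nonneg : ∀ x, 0 ≤ J x
  lsc : LowerSemicontinuous J
  upper : ∀ F : Set X, IsClosed F →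
    limsup (fun i => (μ i F) ^ (t i)) atTop ≤ ⨆ x ∈ F, EReal.exp (- J x)
  lower : ∀ U : Set X, IsOpen U →
    ⨆ x ∈ U, EReal.exp (- J x) ≤ liminf (fun i => (μ i U) ^ (t i)) atTop

end

end LargeDev

namespace LargeDev

variable {ι X : Type*}

/-! Upper bound: Chebyshev with a test function h makes μ_α(V)^{t_α} asymptotically at most about
exp(Λ(h) - h(x)) on a small neighbourhood V of x. Optimising over h gives exp(-J(x)) locally, and
finite covers extend this to compact sets, since finite sums raised to the power t_α → 0 behave like
maxima. Finiteness of L on both sides of 0 makes the tails negligible, hence closed sets.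

Lower bound: if x is a one-sided derivative of L at some s in G, the measure tilted by e^{ry/t_α},
with r near s, concentrates near x; undoing the tilt bounds the mass of every neighbourhood of x
from below by exp(L(s) - sx) ≥ exp(-L_G^*(x)), where L_G^* is the transform of L restricted to G. If
instead l_1(x) ≤ -L(0), the definition of l_1 gives the same bound, because -L(0) ≤ L_G^*(x). As
L_G^* ≤ J, this is the lower bound; comparing it with the local upper bound at x gives L_G^* = J on
Dom(J). -/

/-! ### Sums under vanishing powers. -/

lemma ENNReal_add_rpow_le (a b : ℝ≥0∞) {t : ℝ} (ht : 0 < t) :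
    (a + b) ^ t ≤ 2 ^ t * max (a ^ t) (b ^ t) := by
  have h : a + b ≤ 2 * max a b := by
    rw [two_mul]; exact add_le_add (le_max_left _ _) (le_max_right _ _)
  calc (a + b) ^ t ≤ (2 * max a b) ^ t := ENNReal.rpow_le_rpow h ht.le
    _ = 2 ^ t * (max a b) ^ t := ENNReal.mul_rpow_of_nonneg _ _ ht.le
    _ = 2 ^ t * max (a ^ t) (b ^ t) := by
      rw [(ENNReal.monotone_rpow_of_nonneg ht.le).map_max]

lemma tendsto_two_rpow_mul {l : Filter ι} {t : ι → ℝ} (ht : Tendsto t l (𝓝 0)) (d : ℝ≥0∞) :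
    Tendsto (fun i => (2 : ℝ≥0∞) ^ t i * d) l (𝓝 d) := by
  have h : Tendsto (fun i => (2 : ℝ≥0∞) ^ t i) l (𝓝 1) := by
    have h2 : Tendsto (fun i => ENNReal.ofReal ((2 : ℝ) ^ t i)) l (𝓝 1) := by
      have h3 : Tendsto (fun i => (2 : ℝ) ^ t i) l (𝓝 1) := by
        simpa using (tendsto_const_nhds (x := (2 : ℝ))).rpow ht (Or.inl two_ne_zero)
      simpa using ENNReal.tendsto_ofReal h3
    refine h2.congr fun i => ?_
    rw [← ENNReal.ofReal_rpow_of_pos two_pos]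
    simp
  simpa using ENNReal.Tendsto.mul_const h (Or.inl one_ne_zero)

lemma limsup_add_rpow_le {l : Filter ι} {t : ι → ℝ} (ht_pos : ∀ i, 0 < t i)
    (ht : Tendsto t l (𝓝 0)) {u v w : ι → ℝ≥0∞} (h : ∀ i, u i ≤ v i + w i) :
    limsup (fun i => u i ^ t i) l ≤
      max (limsup (fun i => v i ^ t i) l) (limsup (fun i => w i ^ t i) l) := by
  refine le_of_forall_gt_imp_ge_of_dense fun d hd => ?_
  obtain ⟨e, he, hed⟩ := exists_between hd
  refine limsup_le_of_le (by isBoundedDefault) ?_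
  filter_upwards [eventually_lt_of_limsup_lt ((le_max_left _ _).trans_lt he),
    eventually_lt_of_limsup_lt ((le_max_right _ _).trans_lt he),
    (tendsto_two_rpow_mul ht e).eventually_lt_const hed] with i h1 h2 h3
  calc u i ^ t i ≤ (v i + w i) ^ t i := ENNReal.rpow_le_rpow (h i) (ht_pos i).le
    _ ≤ 2 ^ t i * max (v i ^ t i) (w i ^ t i) := ENNReal_add_rpow_le _ _ (ht_pos i)
    _ ≤ 2 ^ t i * e := by gcongr; exact max_le h1.le h2.le
    _ ≤ d := h3.le

/-- Only one term may keep a liminf: its smallness is merely frequent, so the other must be small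
eventually. This transfers a lower bound on a sum to its dominant term. -/
lemma liminf_add_rpow_le {l : Filter ι} {t : ι → ℝ} (ht_pos : ∀ i, 0 < t i)
    (ht : Tendsto t l (𝓝 0)) {u v w : ι → ℝ≥0∞} (h : ∀ i, u i ≤ v i + w i) :
    liminf (fun i => u i ^ t i) l ≤
      max (liminf (fun i => v i ^ t i) l) (limsup (fun i => w i ^ t i) l) := by
  refine le_of_forall_gt_imp_ge_of_dense fun d hd => ?_
  obtain ⟨e, he, hed⟩ := exists_between hd
  refine liminf_le_of_frequently_le ?_ (by isBoundedDefault)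
  have h1 : ∃ᶠ i in l, v i ^ t i < e :=
    frequently_lt_of_liminf_lt (by isBoundedDefault) ((le_max_left _ _).trans_lt he)
  refine (h1.and_eventually ((eventually_lt_of_limsup_lt ((le_max_right _ _).trans_lt he)).and
    ((tendsto_two_rpow_mul ht e).eventually_lt_const hed))).mono ?_
  rintro i ⟨h1, h2, h3⟩
  calc u i ^ t i ≤ (v i + w i) ^ t i := ENNReal.rpow_le_rpow (h i) (ht_pos i).le
    _ ≤ 2 ^ t i * max (v i ^ t i) (w i ^ t i) := ENNReal_add_rpow_le _ _ (ht_pos i)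
    _ ≤ 2 ^ t i * e := by gcongr; exact max_le h1.le h2.le
    _ ≤ d := h3.le

/-! ### Chebyshev bounds. -/

lemma setLIntegral_exp_rpow_le [MeasurableSpace X] (μ : Measure X) {t : ℝ} (ht : 0 < t)
    {A : Set X} (hA : MeasurableSet A) {f g : X → ℝ} {c : ℝ} (h : ∀ x ∈ A, f x ≤ c + g x) :
    (∫⁻ x in A, ENNReal.ofReal (Real.exp (f x / t)) ∂μ) ^ t ≤
      ENNReal.ofReal (Real.exp c) * (∫⁻ x in A, ENNReal.ofReal (Real.exp (g x / t)) ∂μ) ^ t := by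
  have h1 : ∫⁻ x in A, ENNReal.ofReal (Real.exp (f x / t)) ∂μ ≤
      ENNReal.ofReal (Real.exp (c / t)) * ∫⁻ x in A, ENNReal.ofReal (Real.exp (g x / t)) ∂μ := by
    rw [← lintegral_const_mul' _ _ ENNReal.ofReal_ne_top]
    refine setLIntegral_mono' hA fun x hx => ?_
    rw [← ENNReal.ofReal_mul (Real.exp_pos _).le, ← Real.exp_add, ← add_div]
    exact ENNReal.ofReal_le_ofReal (Real.exp_le_exp.2 (by gcongr; exact h x hx))
  have h2 : ENNReal.ofReal (Real.exp (c / t)) ^ t = ENNReal.ofReal (Real.exp c) := by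
    rw [ENNReal.ofReal_rpow_of_pos (Real.exp_pos _), ← Real.exp_mul, div_mul_cancel₀ _ ht.ne']
  calc _ ≤ _ := ENNReal.rpow_le_rpow h1 ht.le
    _ = _ := by rw [ENNReal.mul_rpow_of_nonneg _ _ ht.le, h2]

lemma limsup_setLIntegral_exp_rpow_le [Preorder ι] [MeasurableSpace X] (μ : ι → Measure X)
    {t : ι → ℝ} (ht_pos : ∀ i, 0 < t i) {A : Set X} (hA : MeasurableSet A) {f g : X → ℝ} {c : ℝ}
    (h : ∀ x ∈ A, f x ≤ c + g x) :
    limsup (fun i => (∫⁻ x in A, ENNReal.ofReal (Real.exp (f x / t i)) ∂(μ i)) ^ t i) atTop ≤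
      ENNReal.ofReal (Real.exp c) * limsup (scaledExpMoment μ t g) atTop := by
  rw [← ENNReal.limsup_const_mul_of_ne_top ENNReal.ofReal_ne_top]
  refine limsup_le_limsup (Eventually.of_forall fun i => ?_)
  refine (setLIntegral_exp_rpow_le (μ i) (ht_pos i) hA h).trans ?_
  exact mul_le_mul_right (ENNReal.rpow_le_rpow (setLIntegral_le_lintegral _ _) (ht_pos i).le) _

lemma limsup_measure_rpow_le [Preorder ι] [MeasurableSpace X] (μ : ι → Measure X)
    {t : ι → ℝ} (ht_pos : ∀ i, 0 < t i) {A : Set X} (hA : MeasurableSet A) {g : X → ℝ} {c : ℝ}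
    (h : ∀ x ∈ A, c ≤ g x) :
    limsup (fun i => μ i A ^ t i) atTop ≤ EReal.exp (upperLambda μ t g - c) := by
  have := limsup_setLIntegral_exp_rpow_le μ ht_pos hA (f := fun _ => 0) (g := g) (c := -c)
    (fun x hx => by linarith [h x hx])
  simp only [zero_div, Real.exp_zero, ENNReal.ofReal_one, setLIntegral_one] at this
  refine this.trans_eq ?_
  rw [sub_eq_add_neg, add_comm, EReal.exp_add, upperLambda, ENNReal.exp_log,
    ← EReal.coe_neg, EReal.exp_coe]

/-! ### Test functions and elementary properties of the rate function. -/

lemma hFun_continuous (a b : ℝ) : Continuous (hFun a b) := by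
  refine Continuous.if_le (by fun_prop) (by fun_prop) continuous_id continuous_const ?_
  rintro x rfl
  simp

lemma hFun_self (a : ℝ) : hFun a a = fun x => a * x := by
  funext x; simp [hFun]

lemma lowerSemicontinuous_abstractConj [TopologicalSpace X] {S : Set (X → ℝ)}
    (hS : ∀ h ∈ S, Continuous h) (Φ : (X → ℝ) → EReal) :
    LowerSemicontinuous (abstractConj S Φ) := by
  refine lowerSemicontinuous_biSup fun h hh => ?_
  have hc := hS h hh
  -- An infinite value of `Φ h` makes the term constant in x.
  induction Φ h with
  | bot => simpa using lowerSemicontinuous_const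
  | top => simpa using lowerSemicontinuous_const
  | coe c =>
    refine Continuous.lowerSemicontinuous ?_
    simp only [← EReal.coe_sub]
    exact continuous_coe_real_ereal.comp (hc.sub continuous_const)

lemma le_abstractConj {S : Set (X → ℝ)} {h : X → ℝ} (hh : h ∈ S) (Φ : (X → ℝ) → EReal) (x : X) :
    ((h x : ℝ) : EReal) - Φ h ≤ abstractConj S Φ x :=
  le_iSup₂ (f := fun (h : X → ℝ) (_ : h ∈ S) => ((h x : ℝ) : EReal) - Φ h) h hh

lemma neg_logMGF_zero_le [Preorder ι] (μ : ι → Measure ℝ) (t : ι → ℝ) (x : ℝ) :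
    - logMGF μ t 0 ≤ abstractConj hFamily (Lambda μ t) x := by
  have := le_abstractConj (S := hFamily) (h := hFun 0 0) ⟨0, 0, rfl⟩ (Lambda μ t) x
  simpa [hFun_self, logMGF] using this

lemma logMGF_zero_nonpos [Preorder ι] (μ : ι → Measure ℝ) (hμ : ∀ i, μ i univ ≤ 1)
    (t : ι → ℝ) (ht_pos : ∀ i, 0 < t i) : logMGF μ t 0 ≤ 0 := by
  rw [logMGF, Lambda, upperLambda, ← ENNReal.log_one]
  refine ENNReal.log_monotone (limsup_le_of_le (by isBoundedDefault) (Eventually.of_forall ?_))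
  intro i
  simpa [scaledExpMoment, hFun_self] using ENNReal.rpow_le_rpow (hμ i) (ht_pos i).le

/-! ### Upper bound: local, compact, closed. -/

lemma exp_neg_lt_iff {a : EReal} {c : ℝ≥0∞} : EReal.exp (-a) < c ↔ -ENNReal.log c < a := by
  rw [EReal.neg_lt_comm, ← EReal.exp_lt_exp_iff (b := ENNReal.log c), ENNReal.exp_log]

lemma continuous_exp_sub_coe (a : EReal) : Continuous fun d : ℝ => EReal.exp (a - d) := by
  refine ENNReal.continuous_exp.comp ?_
  induction a with
  | bot => simpa using continuous_const
  | top => simpa using continuous_const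
  | coe a =>
    simp only [← EReal.coe_sub]
    exact continuous_coe_real_ereal.comp (continuous_const.sub continuous_id)

lemma exists_nhds_limsup_le [Preorder ι] [TopologicalSpace X] [MeasurableSpace X]
    [OpensMeasurableSpace X] (μ : ι → Measure X) {t : ι → ℝ} (ht_pos : ∀ i, 0 < t i)
    {h : X → ℝ} (hh : Continuous h) {x : X} {c : ℝ≥0∞}
    (hc : EReal.exp (-(((h x : ℝ) : EReal) - Lambda μ t h)) < c) :
    ∃ V ∈ 𝓝 x, limsup (fun i => μ i V ^ t i) atTop ≤ c := by
  rw [EReal.neg_sub (Or.inl (EReal.coe_ne_bot _)) (Or.inl (EReal.coe_ne_top _)), add_comm,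
    ← sub_eq_add_neg] at hc
  -- A level d slightly below h(x) keeps the Chebyshev bound under c and makes {h > d} a
  -- neighbourhood of x.
  have h1 : ∀ᶠ d in 𝓝[<] (h x), EReal.exp (Lambda μ t h - (d : ℝ)) < c :=
    ((continuous_exp_sub_coe _).tendsto (h x)).mono_left nhdsWithin_le_nhds
      |>.eventually_lt_const hc
  obtain ⟨d, hd, hdx⟩ := (h1.and self_mem_nhdsWithin).exists
  have hV : IsOpen {y | d < h y} := isOpen_lt continuous_const hh
  exact ⟨_, hV.mem_nhds hdx,
    (limsup_measure_rpow_le μ ht_pos hV.measurableSet fun y hy => le_of_lt hy).trans hd.le⟩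

lemma exists_nhds_limsup_le_of_abstractConj [Preorder ι] [TopologicalSpace X] [MeasurableSpace X]
    [OpensMeasurableSpace X] (μ : ι → Measure X) {t : ι → ℝ} (ht_pos : ∀ i, 0 < t i)
    {S : Set (X → ℝ)} (hS : ∀ h ∈ S, Continuous h) {x : X} {c : ℝ≥0∞}
    (hc : EReal.exp (-abstractConj S (Lambda μ t) x) < c) :
    ∃ V ∈ 𝓝 x, limsup (fun i => μ i V ^ t i) atTop ≤ c := by
  have h1 := exp_neg_lt_iff.1 hc
  simp only [abstractConj, lt_iSup_iff] at h1
  obtain ⟨h, hh, h1⟩ := h1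
  exact exists_nhds_limsup_le μ ht_pos (hS h hh) (exp_neg_lt_iff.2 h1)

lemma limsup_measure_rpow_mono [Preorder ι] [MeasurableSpace X] (μ : ι → Measure X)
    {t : ι → ℝ} (ht_pos : ∀ i, 0 < t i) {A B : Set X} (h : A ⊆ B) :
    limsup (fun i => μ i A ^ t i) atTop ≤ limsup (fun i => μ i B ^ t i) atTop :=
  limsup_le_limsup (Eventually.of_forall fun i =>
    ENNReal.rpow_le_rpow (measure_mono h) (ht_pos i).le)

lemma limsup_measure_rpow_union_le [Preorder ι] [MeasurableSpace X] (μ : ι → Measure X)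
    {t : ι → ℝ} (ht_pos : ∀ i, 0 < t i) (ht : Tendsto t atTop (𝓝 0)) {A B : Set X} {c : ℝ≥0∞}
    (hA : limsup (fun i => μ i A ^ t i) atTop ≤ c)
    (hB : limsup (fun i => μ i B ^ t i) atTop ≤ c) :
    limsup (fun i => μ i (A ∪ B) ^ t i) atTop ≤ c :=
  (limsup_add_rpow_le ht_pos ht fun _ => measure_union_le _ _).trans (max_le hA hB)

lemma limsup_le_of_isCompact [Preorder ι] [TopologicalSpace X] [MeasurableSpace X]
    [OpensMeasurableSpace X] (μ : ι → Measure X) {t : ι → ℝ} (ht_pos : ∀ i, 0 < t i)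
    (ht : Tendsto t atTop (𝓝 0)) {S : Set (X → ℝ)} (hS : ∀ h ∈ S, Continuous h) {K : Set X}
    (hK : IsCompact K) {c : ℝ≥0∞}
    (hc : ∀ x ∈ K, EReal.exp (-abstractConj S (Lambda μ t) x) < c) :
    limsup (fun i => μ i K ^ t i) atTop ≤ c := by
  refine hK.induction_on (p := fun A => limsup (fun i => μ i A ^ t i) atTop ≤ c) ?_
    (fun A B h hB => (limsup_measure_rpow_mono μ ht_pos h).trans hB)
    (fun A B hA hB => limsup_measure_rpow_union_le μ ht_pos ht hA hB) ?_
  · simp only [measure_empty, ENNReal.zero_rpow_of_pos (ht_pos _)]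
    exact limsup_le_of_le (by isBoundedDefault) (Eventually.of_forall fun _ => zero_le)
  · intro x hx
    obtain ⟨V, hV, hVc⟩ := exists_nhds_limsup_le_of_abstractConj μ ht_pos hS (hc x hx)
    exact ⟨V, mem_nhdsWithin_of_mem_nhds hV, hVc⟩

lemma tendsto_exp_sub_coe {a : EReal} (ha : a ≠ ⊤) :
    Tendsto (fun d : ℝ => EReal.exp (a - d)) atTop (𝓝 0) := by
  induction a with
  | bot => simp
  | top => exact absurd rfl ha
  | coe a =>
    simp only [← EReal.coe_sub, EReal.exp_coe]
    rw [← ENNReal.ofReal_zero]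
    refine ENNReal.tendsto_ofReal (Real.tendsto_exp_atBot.comp ?_)
    exact tendsto_atBot_add_const_left _ a tendsto_neg_atTop_atBot

/-- Exponential tightness: the Chebyshev bound exp(L(s) - M) vanishes as M → ∞. Negative s controls
the left tail, positive s the right. -/
lemma exists_tail_limsup_le [Preorder ι] (μ : ι → Measure ℝ) {t : ι → ℝ}
    (ht_pos : ∀ i, 0 < t i) {s : ℝ} (hs : logMGF μ t s ≠ ⊤) {c : ℝ≥0∞} (hc : 0 < c) :
    ∃ M : ℝ, limsup (fun i => μ i {x | M ≤ s * x} ^ t i) atTop ≤ c := by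
  obtain ⟨M, hM⟩ := ((tendsto_exp_sub_coe hs).eventually_lt_const hc).exists
  refine ⟨M, (limsup_measure_rpow_le μ ht_pos ?_ (g := hFun s s) (c := M) ?_).trans hM.le⟩
  · exact measurableSet_le measurable_const (by fun_prop)
  · intro x hx
    simpa [hFun_self] using hx

lemma limsup_le_of_isClosed [Preorder ι] (μ : ι → Measure ℝ) {t : ι → ℝ}
    (ht_pos : ∀ i, 0 < t i) (ht : Tendsto t atTop (𝓝 0)) {S : Set (ℝ → ℝ)}
    (hS : ∀ h ∈ S, Continuous h) {a b : ℝ} (ha : a < 0) (hb : 0 < b) (hLa : logMGF μ t a ≠ ⊤)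
    (hLb : logMGF μ t b ≠ ⊤) {F : Set ℝ} (hF : IsClosed F) :
    limsup (fun i => μ i F ^ t i) atTop ≤
      ⨆ x ∈ F, EReal.exp (-abstractConj S (Lambda μ t) x) := by
  refine le_of_forall_gt_imp_ge_of_dense fun c hc => ?_
  have hc0 : 0 < c := bot_le.trans_lt hc
  obtain ⟨M, hM⟩ := exists_tail_limsup_le μ ht_pos hLa hc0
  obtain ⟨N, hN⟩ := exists_tail_limsup_le μ ht_pos hLb hc0
  have hK : IsCompact (F ∩ Icc (M / a) (N / b)) := isCompact_Icc.inter_left hF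
  have hKc := limsup_le_of_isCompact μ ht_pos ht hS hK (c := c) fun x hx =>
    (le_iSup₂ (f := fun x (_ : x ∈ F) => EReal.exp (-abstractConj S (Lambda μ t) x))
      x hx.1).trans_lt hc
  refine (limsup_measure_rpow_mono μ ht_pos fun x hx => ?_).trans
    (limsup_measure_rpow_union_le μ ht_pos ht
      (limsup_measure_rpow_union_le μ ht_pos ht hKc hM) hN)
  by_cases h1 : M ≤ a * x
  · exact Or.inl (Or.inr h1)
  by_cases h2 : N ≤ b * x
  · exact Or.inr h2
  refine Or.inl (Or.inl ⟨hx, ?_, ?_⟩)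
  · rw [div_le_iff_of_neg ha]; linarith
  · rw [le_div_iff₀ hb]; linarith

/-! ### Lower bound by tilting. -/

/-- If the exponential moments of order `a < r < b` have logarithmic limits `l a`, `l r`, `l b`
whose slopes on `[a, r]` and `[r, b]` are compatible with `x`, then the tilted measure of order `r`
charges every ball around `x`. -/
lemma le_liminf_measure_ball [Preorder ι] [IsDirectedOrder ι] [Nonempty ι] (μ : ι → Measure ℝ)
    {t : ι → ℝ} (ht_pos : ∀ i, 0 < t i) (ht : Tendsto t atTop (𝓝 0)) {l : ℝ → ℝ} {a r b x δ : ℝ}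
    (har : a < r) (hrb : r < b) (hla : logMGF μ t a = l a) (hlb : logMGF μ t b = l b)
    (hlr : lowerLambda μ t (hFun r r) = l r) (h1 : (r - a) * (x - δ) < l r - l a)
    (h2 : l b - l r < (b - r) * (x + δ)) :
    ENNReal.ofReal (Real.exp (l r - r * x - |r| * δ)) ≤
      liminf (fun i => μ i (Metric.ball x δ) ^ t i) atTop := by
  have key : ∀ s, logMGF μ t s = l s →
      limsup (scaledExpMoment μ t (hFun s s)) atTop = ENNReal.ofReal (Real.exp (l s)) := by
    intro s hs
    rw [← EReal.exp_coe, ← hs, logMGF, Lambda, upperLambda, ENNReal.exp_log]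
  have hr : liminf (scaledExpMoment μ t (hFun r r)) atTop = ENNReal.ofReal (Real.exp (l r)) := by
    rw [← EReal.exp_coe, ← hlr, lowerLambda, ENNReal.exp_log]
  set I : Set ℝ → ι → ℝ≥0∞ :=
    fun A i => ∫⁻ y in A, ENNReal.ofReal (Real.exp (hFun r r y / t i)) ∂(μ i) with hI
  have hsmall : ∀ s c A, logMGF μ t s = l s → MeasurableSet A →
      (∀ y ∈ A, hFun r r y ≤ c + hFun s s y) → c + l s < l r →
      limsup (fun i => I A i ^ t i) atTop < ENNReal.ofReal (Real.exp (l r)) := by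
    intro s c A hs hA h hlt
    refine (limsup_setLIntegral_exp_rpow_le μ ht_pos hA h).trans_lt ?_
    rw [key s hs, ← ENNReal.ofReal_mul (Real.exp_pos _).le, ← Real.exp_add]
    exact (ENNReal.ofReal_lt_ofReal_iff (Real.exp_pos _)).2 (Real.exp_lt_exp.2 hlt)
  -- Left of the ball, ry ≤ (r - a)(x - δ) + ay, so the tilted tail has exponent at most (r - a)(x -
  -- δ) + l(a) < l(r). The right tail is symmetric, with b.
  have hlow := hsmall a ((r - a) * (x - δ)) (Iic (x - δ)) hla measurableSet_Iic
    (fun y hy => by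
      simp only [hFun_self]
      nlinarith [mul_le_mul_of_nonneg_left (mem_Iic.1 hy) (sub_pos.2 har).le]) (by linarith)
  have hhigh := hsmall b (-((b - r) * (x + δ))) (Ici (x + δ)) hlb measurableSet_Ici
    (fun y hy => by
      simp only [hFun_self]
      nlinarith [mul_le_mul_of_nonneg_left (mem_Ici.1 hy) (sub_pos.2 hrb).le]) (by linarith)
  have hcover : ∀ i, I univ i ≤
      I (Metric.ball x δ) i + (I (Iic (x - δ)) i + I (Ici (x + δ)) i) := by
    intro i
    refine le_trans ?_ ((lintegral_union_le _ _ _).trans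
      (add_le_add le_rfl (lintegral_union_le _ _ _)))
    refine lintegral_mono_set fun y _ => ?_
    rw [Real.ball_eq_Ioo]
    by_cases h3 : y ≤ x - δ
    · exact Or.inr (Or.inl h3)
    by_cases h4 : x + δ ≤ y
    · exact Or.inr (Or.inr h4)
    exact Or.inl ⟨not_le.1 h3, not_le.1 h4⟩
  have hball : ENNReal.ofReal (Real.exp (l r)) ≤
      liminf (fun i => I (Metric.ball x δ) i ^ t i) atTop := by
    have h3 := liminf_add_rpow_le ht_pos ht hcover
    have h4 : liminf (fun i => I univ i ^ t i) atTop = ENNReal.ofReal (Real.exp (l r)) := by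
      rw [← hr]; simp only [hI, setLIntegral_univ]; rfl
    rw [h4] at h3
    -- The total tilted mass has exponent l(r) and both tails are strictly smaller, so the ball must
    -- carry it.
    refine (le_max_iff.1 h3).resolve_right (not_le.2 ?_)
    exact (limsup_add_rpow_le ht_pos ht fun _ => le_rfl).trans_lt (max_lt hlow hhigh)
  -- Undoing the tilt: ry ≤ rx + |r|δ on the ball.
  have hle : liminf (fun i => I (Metric.ball x δ) i ^ t i) atTop ≤
      ENNReal.ofReal (Real.exp (r * x + |r| * δ)) *
        liminf (fun i => μ i (Metric.ball x δ) ^ t i) atTop := by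
    rw [← ENNReal.liminf_const_mul_of_ne_top ENNReal.ofReal_ne_top]
    refine liminf_le_liminf (Eventually.of_forall fun i => ?_)
    have := setLIntegral_exp_rpow_le (μ i) (ht_pos i) (A := Metric.ball x δ)
      measurableSet_ball (f := hFun r r) (g := fun _ => 0) (c := r * x + |r| * δ) ?_
    · simpa using this
    · intro y hy
      rw [Metric.mem_ball, Real.dist_eq] at hy
      have h5 : r * (y - x) ≤ |r| * |y - x| := (le_abs_self _).trans_eq (abs_mul _ _)
      have h6 := mul_le_mul_of_nonneg_left hy.le (abs_nonneg r)
      simp only [hFun_self]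
      linarith
  have h7 := mul_le_mul_right (hball.trans hle)
    (ENNReal.ofReal (Real.exp (-(r * x + |r| * δ))))
  rw [← mul_assoc, ← ENNReal.ofReal_mul (Real.exp_pos _).le,
    ← ENNReal.ofReal_mul (Real.exp_pos _).le, ← Real.exp_add, ← Real.exp_add, neg_add_cancel,
    Real.exp_zero, ENNReal.ofReal_one, one_mul] at h7
  refine le_trans (le_of_eq ?_) h7
  congr 2; ring

lemma eventually_abs_sub_le_of_hasDerivWithinAt {l : ℝ → ℝ} {G T : Set ℝ} (hG : IsOpen G)
    {s x σ : ℝ} (hs : s ∈ G) (hT : ∀ η > 0, s + σ * η ∈ T)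
    (hl : HasDerivWithinAt l x (G ∩ T) s) {c : ℝ} (hc : 0 < c) :
    ∀ᶠ η in 𝓝[>] (0 : ℝ), s + σ * η ∈ G ∧ |l (s + σ * η) - l s - σ * η * x| ≤ c * |σ * η| := by
  have h0 : Tendsto (fun η : ℝ => s + σ * η) (𝓝[>] 0) (𝓝 s) :=
    (Continuous.tendsto' (by fun_prop) 0 s (by simp)).mono_left nhdsWithin_le_nhds
  have h1 : ∀ᶠ η in 𝓝[>] (0 : ℝ), s + σ * η ∈ G := h0.eventually (hG.mem_nhds hs)
  have h2 : Tendsto (fun η : ℝ => s + σ * η) (𝓝[>] 0) (𝓝[G ∩ T] s) := by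
    refine tendsto_nhdsWithin_iff.2 ⟨h0, ?_⟩
    filter_upwards [h1, self_mem_nhdsWithin] with η h3 h4 using ⟨h3, hT η h4⟩
  filter_upwards [h1, h2.eventually (hl.isLittleO.def hc)] with η h3 h4
  exact ⟨h3, by simpa using h4⟩

/-- Only one side of s is controlled, so r cannot be s itself: the points are s - 2η, s - η, s or s,
s + η, s + 2η, and both adjacent slopes tend to x as η → 0. -/
lemma exists_slopes_near {l : ℝ → ℝ} {G : Set ℝ} (hG : IsOpen G) {s x : ℝ} (hs : s ∈ G)
    (hl : HasDerivWithinAt l x (G ∩ Iio s) s ∨ HasDerivWithinAt l x (G ∩ Ioi s) s)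
    {δ ε : ℝ} (hδ : 0 < δ) (hε : 0 < ε) :
    ∃ a ∈ G, ∃ r ∈ G, ∃ b ∈ G, a < r ∧ r < b ∧ (r - a) * (x - δ) < l r - l a ∧
      l b - l r < (b - r) * (x + δ) ∧ l s - s * x - |s| * δ - ε < l r - r * x - |r| * δ := by
  -- The first-order errors at distances η and 2η then total at most 3δη/4 < δη. In the last
  -- inequality the loss is at most 5δη/4, covered by 2δη < ε.
  have hc : 0 < δ / 4 := by positivity
  have hη : ∀ᶠ η in 𝓝[>] (0 : ℝ), 2 * δ * η < ε := by
    refine Tendsto.eventually_lt_const hε ?_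
    exact (Continuous.tendsto' (by fun_prop) 0 0 (by simp)).mono_left nhdsWithin_le_nhds
  rcases hl with hl | hl
  · obtain ⟨η, ⟨hr, h1⟩, ⟨ha, h2⟩, h3, h4⟩ :=
      ((eventually_abs_sub_le_of_hasDerivWithinAt hG (σ := -1) hs
        (fun η h => by simpa using h) hl hc).and
      ((eventually_abs_sub_le_of_hasDerivWithinAt hG (σ := -2) hs
        (fun η h => by simpa using h) hl hc).and (hη.and self_mem_nhdsWithin))).exists
    replace h4 : 0 < η := h4
    rw [abs_mul, abs_of_pos h4, abs_le] at h1 h2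
    norm_num at h1 h2
    have h5 : |s + -1 * η| ≤ |s| + η := by
      simpa [abs_of_pos h4] using abs_add_le s (-1 * η)
    have h6 := mul_le_mul_of_nonneg_right h5 hδ.le
    have h7 := mul_pos hδ h4
    norm_num at h6 hr ha
    refine ⟨_, ha, _, hr, s, hs, ?_, ?_, ?_, ?_, ?_⟩ <;> nlinarith
  · obtain ⟨η, ⟨hr, h1⟩, ⟨ha, h2⟩, h3, h4⟩ :=
      ((eventually_abs_sub_le_of_hasDerivWithinAt hG (σ := 1) hs
        (fun η h => by simpa using h) hl hc).and
      ((eventually_abs_sub_le_of_hasDerivWithinAt hG (σ := 2) hs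
        (fun η h => by simpa using h) hl hc).and (hη.and self_mem_nhdsWithin))).exists
    replace h4 : 0 < η := h4
    rw [abs_mul, abs_of_pos h4, abs_le] at h1 h2
    norm_num at h1 h2
    have h5 : |s + 1 * η| ≤ |s| + η := by
      simpa [abs_of_pos h4] using abs_add_le s (1 * η)
    have h6 := mul_le_mul_of_nonneg_right h5 hδ.le
    have h7 := mul_pos hδ h4
    norm_num at h6 hr ha
    refine ⟨s, hs, _, hr, _, ha, ?_, ?_, ?_, ?_, ?_⟩ <;> nlinarith

lemma le_liminf_measure_of_hasDerivWithinAt [Preorder ι] [IsDirectedOrder ι] [Nonempty ι]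
    (μ : ι → Measure ℝ) {t : ι → ℝ} (ht_pos : ∀ i, 0 < t i) (ht : Tendsto t atTop (𝓝 0))
    {l : ℝ → ℝ} {G : Set ℝ} (hG : IsOpen G) (hl : ∀ r ∈ G, logMGF μ t r = l r)
    (hex : ∀ r ∈ G, LambdaExists μ t (hFun r r)) {s x : ℝ} (hs : s ∈ G)
    (hd : HasDerivWithinAt l x (G ∩ Iio s) s ∨ HasDerivWithinAt l x (G ∩ Ioi s) s)
    {U : Set ℝ} (hU : IsOpen U) (hx : x ∈ U) :
    EReal.exp ((l s - s * x : ℝ) : EReal) ≤ liminf (fun i => μ i U ^ t i) atTop := by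
  obtain ⟨ρ, hρ, hρU⟩ := Metric.isOpen_iff.1 hU x hx
  have hball : ∀ δ > 0, δ ≤ ρ → EReal.exp ((l s - s * x - |s| * δ - δ : ℝ) : EReal) ≤
      liminf (fun i => μ i U ^ t i) atTop := by
    intro δ hδ hδρ
    obtain ⟨a, ha, r, hr, b, hb, har, hrb, h1, h2, h3⟩ := exists_slopes_near hG hs hd hδ hδ
    refine le_trans ?_ ((le_liminf_measure_ball μ ht_pos ht har hrb (hl a ha) (hl b hb)
      ((hex r hr).trans (hl r hr)) h1 h2).trans (liminf_le_liminf (Eventually.of_forall fun i =>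
        ENNReal.rpow_le_rpow (measure_mono ((Metric.ball_subset_ball hδρ).trans hρU))
          (ht_pos i).le)))
    rw [← EReal.exp_coe, EReal.exp_le_exp_iff, EReal.coe_le_coe_iff]
    exact h3.le
  have hlim : Tendsto (fun δ : ℝ => EReal.exp ((l s - s * x - |s| * δ - δ : ℝ) : EReal))
      (𝓝[>] 0) (𝓝 (EReal.exp ((l s - s * x : ℝ) : EReal))) := by
    refine (Continuous.tendsto' ?_ 0 _ (by simp)).mono_left nhdsWithin_le_nhds
    exact ENNReal.continuous_exp.comp (continuous_coe_real_ereal.comp (by fun_prop))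
  refine le_of_tendsto hlim ?_
  filter_upwards [Ioc_mem_nhdsGT hρ] with δ hδ using hball δ hδ.1 hδ.2

/-! ### Comparison of the two transforms. -/

lemma le_legendre_extendTop (f : ℝ → EReal) {G : Set ℝ} {s : ℝ} (hs : s ∈ G) (x : ℝ) :
    ((s * x : ℝ) : EReal) - f s ≤ legendre (extendTop f G) x := by
  have := le_iSup (fun s : ℝ => ((s * x : ℝ) : EReal) - extendTop f G s) s
  simpa [legendre, extendTop, hs] using this

lemma legendre_extendTop_le [Preorder ι] (μ : ι → Measure ℝ) (t : ι → ℝ) (G : Set ℝ) (x : ℝ) :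
    legendre (extendTop (logMGF μ t) G) x ≤ abstractConj hFamily (Lambda μ t) x := by
  refine iSup_le fun s => ?_
  by_cases hs : s ∈ G
  · have := le_abstractConj (S := hFamily) (h := hFun s s) ⟨s, s, rfl⟩ (Lambda μ t) x
    simpa [extendTop, hs, logMGF, hFun_self] using this
  · simp [extendTop, hs]

lemma exp_neg_legendre_le_liminf [Preorder ι] [IsDirectedOrder ι] [Nonempty ι]
    (μ : ι → Measure ℝ) {t : ι → ℝ} (ht_pos : ∀ i, 0 < t i) (ht : Tendsto t atTop (𝓝 0))
    {G : Set ℝ} (hG : IsOpen G) (hG_zero : (0 : ℝ) ∈ G)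
    (hfin : ∀ s ∈ G, logMGF μ t s ≠ ⊥ ∧ logMGF μ t s ≠ ⊤)
    (hex : ∀ r ∈ G, LambdaExists μ t (hFun r r)) {x : ℝ}
    (hx : - logMGF μ t 0 < lOne μ t x →
      x ∈ ranLeftDeriv (logMGF μ t) G ∪ ranRightDeriv (logMGF μ t) G)
    {U : Set ℝ} (hU : IsOpen U) (hxU : x ∈ U) :
    EReal.exp (-legendre (extendTop (logMGF μ t) G) x) ≤
      liminf (fun i => μ i U ^ t i) atTop := by
  by_cases h : - logMGF μ t 0 < lOne μ t x
  · have hd : ∃ s ∈ G, HasDerivWithinAt (fun r => (logMGF μ t r).toReal) x (G ∩ Iio s) s ∨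
        HasDerivWithinAt (fun r => (logMGF μ t r).toReal) x (G ∩ Ioi s) s := by
      rcases hx h with ⟨s, hs, hd⟩ | ⟨s, hs, hd⟩
      exacts [⟨s, hs, Or.inl hd⟩, ⟨s, hs, Or.inr hd⟩]
    obtain ⟨s, hs, hd⟩ := hd
    have hl : ∀ r ∈ G, logMGF μ t r = ((logMGF μ t r).toReal : EReal) := fun r hr =>
      (EReal.coe_toReal (hfin r hr).2 (hfin r hr).1).symm
    refine le_trans (EReal.exp_monotone ?_)
      (le_liminf_measure_of_hasDerivWithinAt μ ht_pos ht hG hl hex hs hd hU hxU)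
    rw [EReal.neg_le]
    refine le_trans ?_ (le_legendre_extendTop _ hs x)
    nth_rw 2 [hl s hs]
    rw [← EReal.coe_neg, ← EReal.coe_sub, EReal.coe_le_coe_iff]
    linarith
  -- No derivative is available here; s = 0 in the transform gives l_1(x) ≤ -L(0) ≤ L_G^*(x).
  · have h1 : - legendre (extendTop (logMGF μ t) G) x ≤ - lOne μ t x := by
      rw [EReal.neg_le_neg_iff]
      refine (not_lt.1 h).trans ?_
      simpa using le_legendre_extendTop (logMGF μ t) hG_zero x
    refine (EReal.exp_monotone h1).trans ?_
    rw [lOne, neg_neg, ENNReal.exp_log]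
    exact iInf₂_le U ⟨hU, hxU⟩

end LargeDev

theorem mainTheorem3 {ι : Type*} [Preorder ι] [IsDirectedOrder ι] [Nonempty ι]
    (μ : ι → Measure ℝ) (hμ : ∀ i, μ i univ ≤ 1)
    (t : ι → ℝ) (ht_pos : ∀ i, 0 < t i) (ht_lim : Tendsto t atTop (𝓝 0))
    (hΛ : ∀ a b : ℝ, LargeDev.LambdaExists μ t (LargeDev.hFun a b))
    (G : Set ℝ) (hG_open : IsOpen G) (hG_interval : G.OrdConnected) (hG_zero : (0 : ℝ) ∈ G)
    (hL_finite : ∀ s ∈ G, LargeDev.logMGF μ t s ≠ ⊥ ∧ LargeDev.logMGF μ t s ≠ ⊤)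
    (hran : LargeDev.effDom (LargeDev.abstractConj LargeDev.hFamily (LargeDev.Lambda μ t)) ∩
        {x : ℝ | - LargeDev.logMGF μ t 0 < LargeDev.lOne μ t x} ⊆
      LargeDev.ranLeftDeriv (LargeDev.logMGF μ t) G ∪
        LargeDev.ranRightDeriv (LargeDev.logMGF μ t) G) :
    LargeDev.NarrowLDP μ t (LargeDev.abstractConj LargeDev.hFamily (LargeDev.Lambda μ t)) ∧
    ∀ x ∈ LargeDev.effDom (LargeDev.abstractConj LargeDev.hFamily (LargeDev.Lambda μ t)),
      LargeDev.abstractConj LargeDev.hFamily (LargeDev.Lambda μ t) x =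
        LargeDev.legendre (LargeDev.extendTop (LargeDev.logMGF μ t) G) x := by
  have hG0 := hG_open.mem_nhds hG_zero
  obtain ⟨ρ, hρ, hρG⟩ := Metric.mem_nhds_iff.1 hG0
  have hρ2 : ∀ s : ℝ, |s| = ρ / 2 → LargeDev.logMGF μ t s ≠ ⊤ := fun s hs =>
    (hL_finite s (hρG (by simp [hs, hρ]))).2
  have hlow : ∀ x ∈ LargeDev.effDom (LargeDev.abstractConj LargeDev.hFamily (LargeDev.Lambda μ t)),
      ∀ U : Set ℝ, IsOpen U → x ∈ U →
        EReal.exp (-LargeDev.legendre (LargeDev.extendTop (LargeDev.logMGF μ t) G) x) ≤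
          liminf (fun i => μ i U ^ t i) atTop := fun x hx U hU hxU =>
    LargeDev.exp_neg_legendre_le_liminf μ ht_pos ht_lim hG_open hG_zero hL_finite
      (fun r _ => hΛ r r) (fun h => hran ⟨hx, h⟩) hU hxU
  have hcont : ∀ h ∈ LargeDev.hFamily, Continuous h := by
    rintro _ ⟨a, b, rfl⟩
    exact LargeDev.hFun_continuous a b
  refine ⟨⟨fun x => ?_, LargeDev.lowerSemicontinuous_abstractConj hcont _, fun F hF => ?_,
    fun U hU => iSup₂_le fun x hxU => ?_⟩, fun x hx => ?_⟩
  · refine le_trans ?_ (LargeDev.neg_logMGF_zero_le μ t x)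
    simpa [EReal.le_neg] using LargeDev.logMGF_zero_nonpos μ hμ t ht_pos
  · exact LargeDev.limsup_le_of_isClosed μ ht_pos ht_lim hcont (a := -(ρ / 2)) (b := ρ / 2)
      (by linarith) (by linarith) (hρ2 _ (by rw [abs_neg, abs_of_pos (by linarith)]))
      (hρ2 _ (by rw [abs_of_pos (by linarith)])) hF
  · by_cases hx : x ∈ LargeDev.effDom
        (LargeDev.abstractConj LargeDev.hFamily (LargeDev.Lambda μ t))
    · exact (EReal.exp_monotone (EReal.neg_le_neg_iff.2
        (LargeDev.legendre_extendTop_le μ t G x))).trans (hlow x hx U hU hxU)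
    · have : LargeDev.abstractConj LargeDev.hFamily (LargeDev.Lambda μ t) x = ⊤ :=
        not_lt_top_iff.1 hx
      simp [this]
  · refine le_antisymm ?_ (LargeDev.legendre_extendTop_le μ t G x)
    -- On a small open U around x, exp(-L_G^*(x)) ≤ liminf ≤ limsup ≤ c for every c > exp(-J(x)).
    rw [← EReal.neg_le_neg_iff, ← EReal.exp_le_exp_iff]
    refine le_of_forall_gt_imp_ge_of_dense fun c hc => ?_
    obtain ⟨V, hV, hVc⟩ := LargeDev.exists_nhds_limsup_le_of_abstractConj μ ht_pos hcont hc
    obtain ⟨U, hUV, hU, hxU⟩ := mem_nhds_iff.1 hV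
    have hle : liminf (fun i => μ i U ^ t i) atTop ≤ limsup (fun i => μ i U ^ t i) atTop :=
      liminf_le_limsup
    exact (hlow x hx U hU hxU).trans (hle.trans
      ((LargeDev.limsup_measure_rpow_mono μ ht_pos hUV).trans hVc))
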